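/- Let $X$ be a real Banach space with topological dual $X^*$. A function $f\colon X\to\mathbb{R}$ is \emph{quasidifferentiable} at $x$ with quasidifferential $[\underline{\partial} f(x),\overline{\partial} f(x)]$ if $\underline{\partial} f(x),\overline{\partial} f(x)\subset X^*$ are convex and weak$^*$ compact, and for every $v\in X$ the limit $f'(x,v)=\lim_{\alpha\to+0}\frac{f(x+\alpha v)-f(x)}{\alpha}$ exists, is finite and satisfies $$f'(x,v)=\max_{x^*\in\underline{\partial} f(x)}\langle x^*,v\rangle+\min_{y^*\in\overline{\partial} f(x)}\langle y^*,v\rangle .$$ It is quasidifferentiable at $x$ \emph{uniformly along finite dimensional spaces} if, moreover, for every $v\in X$ and every finite dimensional subspace $X_0\subset X$, $$f'(x,v)=\lim_{[\alpha,v']\to[+0,v],\ v'\in v+X_0}\frac{f(x+\alpha v')-f(x)}{\alpha}.$$ For $C\subset X^*$ and $v\in X$ put $s(C,v)=\sup_{x^*\in C}\langle x^*,v\rangle$. The \emph{contingent cone} $T_M(x)$ to a set $M\subset X$ at $x\in M$ is the set of all $v\in X$ for which there are $\alpha_n>0$ and $v_n\in X$ with $\alpha_n\to 0$, $v_n\to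 v$ and $x+\alpha_n v_n\in M$ for all $n$. Let $I=\{1,\dots,m\}$ and $J=\{1,\dots,l\}$ (either may be empty), let $f_i,g_j\colon X\to\mathbb{R}$ for $i\in I$, $j\in J$, and let $$M=\{x\in X\mid f_i(x)=0\ \ \forall i\in I,\quad g_j(x)\le 0\ \ \forall j\in J\},\qquad J(x)=\{j\in J\mid g_j(x)=0\}.$$ \textbf{Theorem.} Let $\overline{x}\in M$. Suppose that the functions $f_i$, $i\in I$, are continuous in a neighbourhood of $\overline{x}$, that the functions $g_j$, $j\in J\setminus J(\overline{x})$, are upper semicontinuous at $\overline{x}$, and that $f_i$, $i\in I$, and $g_j$, $j\in J(\overline{x})$, are quasidifferentiable at $\overline{x}$ uniformly along finite dimensional spaces, with given quasidifferentials $[\underline{\partial} f_i(\overline{x}),\overline{\partial} f_i(\overline{x})]$ and $[\underline{\partial} g_j(\overline{x}),\overline{\partial} g_j(\overline{x})]$. Let $x_i^*\in\underline{\partial} f_i(\overline{x})$ and $y_i^*\in\overline{\partial} f_i(\overline{x})$ for $i\in I$, and $z_j^*\in\overline{\partial} g_j(\overline{x})$ for $j\in J(\overline{x})$, be such that: 1.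 for every $i\in I$ there is $v_i\in X$ with $s(\underline{\partial} f_i(\overline{x})+y_i^*,v_i)<0$ and, for all $k\in I$, $k\ne i$, $s(\underline{\partial} f_k(\overline{x})+y_k^*,v_i)\le 0$ and $s(-x_k^*-\overline{\partial} f_k(\overline{x}),v_i)\le 0$; 2. for every $i\in I$ there is $w_i\in X$ with $s(-x_i^*-\overline{\partial} f_i(\overline{x}),w_i)<0$ and, for all $k\in I$, $k\ne i$, $s(-x_k^*-\overline{\partial} f_k(\overline{x}),w_i)\le 0$ and $s(\underline{\partial} f_k(\overline{x})+y_k^*,w_i)\le 0$; 3. there is $v_0\in X$ with $s(\underline{\partial} g_j(\overline{x})+z_j^*,v_0)<0$ for all $j\in J(\overline{x})$, and $s(\underline{\partial} f_i(\overline{x})+y_i^*,v_0)\le 0$ and $s(-x_i^*-\overline{\partial} f_i(\overline{x}),v_0)\le 0$ for all $i\in I$. Then $$\Big\{v\in X\ \Big|\ s(\underline{\partial} f_i(\overline{x})+y_i^*,v)\le 0,\ s(-x_i^*-\overline{\partial} f_i(\overline{x}),v)\le 0\ \ \forall i\in I,\quad s(\underline{\partial} g_j(\overline{x})+z_j^*,v)\le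 0\ \ \forall j\in J(\overline{x})\Big\}\subseteq T_M(\overline{x}).$$ -/

import Mathlib

open Filter Topology
open scoped Pointwise

namespace Quasidiff

variable {X : Type*} [NormedAddCommGroup X] [NormedSpace ℝ X]

/-- `d` is the one-sided directional derivative `f'(x, v)`, the limit of
`(f (x + α v) - f x) / α` as `α → +0`. -/
def HasDirDerivAt (f : X → ℝ) (d : ℝ) (x v : X) : Prop :=
  Tendsto (fun α : ℝ => (f (x + α • v) - f x) / α) (𝓝[>] 0) (𝓝 d)

/-- `f` is directionally differentiable at `x` uniformly along finite dimensional spaces: for every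
`v` the directional derivative `d = f'(x, v)` exists and, for every finite dimensional subspace
`X₀`, it is the limit of `(f (x + α v') - f x) / α` as `α → +0` and `v' → v` with
`v' ∈ v + X₀`. -/
def DirDifferentiableAtUnif (f : X → ℝ) (x : X) : Prop :=
  ∀ v : X, ∃ d : ℝ, HasDirDerivAt f d x v ∧
    ∀ X₀ : Submodule ℝ X, FiniteDimensional ℝ X₀ →
      Tendsto (fun p : ℝ × X => (f (x + p.1 • p.2) - f x) / p.1)
        (𝓝[>] (0 : ℝ) ×ˢ 𝓝[{v' : X | v' - v ∈ X₀}] v) (𝓝 d)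

/-- The pair `[A, B]` of sets of continuous linear functionals is a quasidifferential of `f` at `x`:
both sets are convex and weak* compact, `f` is directionally differentiable at `x`, and
`f'(x, v) = max_{φ ∈ A} φ v + min_{ψ ∈ B} ψ v` for all `v` (the maximum and the minimum being
attained, so that both sets are nonempty). The type `WeakDual ℝ X` is the topological dual of `X`
endowed with the weak* topology. -/
structure IsQuasidifferentialAt (f : X → ℝ) (x : X) (A B : Set (WeakDual ℝ X)) : Prop where
  convex_sub : Convex ℝ A
  isCompact_sub : IsCompact A
  convex_super : Convex ℝ B
  isCompact_super : IsCompact B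
  hasDirDerivAt : ∀ v : X, ∃ a b : ℝ,
    IsGreatest ((fun φ : WeakDual ℝ X => φ v) '' A) a ∧
    IsLeast ((fun ψ : WeakDual ℝ X => ψ v) '' B) b ∧
    HasDirDerivAt f (a + b) x v

/-- `f` is quasidifferentiable at `x` uniformly along finite dimensional spaces, with the
quasidifferential `[A, B]`. -/
structure IsQuasidifferentialAtUnif (f : X → ℝ) (x : X) (A B : Set (WeakDual ℝ X)) : Prop
    extends IsQuasidifferentialAt f x A B where
  dirDifferentiableAtUnif : DirDifferentiableAtUnif f x

/-- The support function `s(C, v) = sup_{φ ∈ C} φ v`, with values in the extended reals. -/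
noncomputable def supportFn (C : Set (WeakDual ℝ X)) (v : X) : EReal :=
  ⨆ φ ∈ C, ((φ v : ℝ) : EReal)

/-- The contingent cone to `M` at `x`: all limits `v` of sequences `v_n` such that
`x + α_n v_n ∈ M` for some `α_n > 0` converging to zero. -/
def contingentCone (M : Set X) (x : X) : Set X :=
  {v | ∃ (α : ℕ → ℝ) (u : ℕ → X), (∀ n, 0 < α n) ∧ Tendsto α atTop (𝓝 0) ∧
    Tendsto u atTop (𝓝 v) ∧ ∀ n, x + α n • u n ∈ M}

/-- The set `M` given by the equality constraints `f i = 0` and the inequality constraints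
`g j ≤ 0`. -/
def constraintSet {m l : ℕ} (f : Fin m → X → ℝ) (g : Fin l → X → ℝ) : Set X :=
  {x | (∀ i, f i x = 0) ∧ ∀ j, g j x ≤ 0}

/-- The set `J(x)` of the indices of the inequality constraints that are active at `x`. -/
def activeSet {l : ℕ} (g : Fin l → X → ℝ) (x : X) : Set (Fin l) :=
  {j | g j x = 0}

end Quasidiff

namespace Quasidiff

/-! A quasidifferentiable `f` satisfies f'(x, v) ≤ max over A + ψ for every ψ ∈ B, and f'(x, v) ≥
min over φ + B for every φ ∈ A, so the hypotheses are sign conditions on bounds for the directional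
derivatives. Given an admissible v, the shift u = v + s v₀ makes the active inequality constraints
strictly decreasing. The family P t = u + ∑ (tᵢ⁺ wᵢ + tᵢ⁻ vᵢ) then gives the derivative of fᵢ along
P t the sign of tᵢ. By compactness fᵢ(x̄ + α P t) has this sign on the whole faces tᵢ = ±r for all
small α > 0, and `exists_eq_zero_of_face_signs` (Poincaré–Miranda) provides t with every fᵢ(x̄ + α P
t) = 0.

The topological input is that x + h x has a zero when h is continuous with compact support. For
smooth h without such a zero, let δ > 0 be the minimum of |x + h x|² on a ball supporting h. The
identity `setIntegral_pow_id_add` fails for large N: its left side is at least of order (K - δ/2)^N,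
its right side at most of order (K - δ)^N. -/

/-! ### Zeros of compactly supported perturbations of the identity -/

open MeasureTheory in
/-- The integral of a polynomial in `t` whose coefficients are continuous functions is a polynomial
in `t`. -/
theorem exists_polynomial_eval_eq_setIntegral {E : Type*} [TopologicalSpace E] [MeasurableSpace E]
    [OpensMeasurableSpace E] [T2Space E] {μ : Measure E} [IsFiniteMeasureOnCompacts μ] {B : Set E}
    (hB : IsCompact B) (P : Polynomial C(E, ℝ)) :
    ∃ Q : Polynomial ℝ, ∀ t : ℝ,
      ∫ x in B, P.eval₂ (ContinuousMap.evalAlgHom ℝ ℝ x : C(E, ℝ) →+* ℝ) t ∂μ = Q.eval t := by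
  refine ⟨∑ k ∈ P.support, Polynomial.monomial k (∫ x in B, P.coeff k x ∂μ), fun t => ?_⟩
  simp only [Polynomial.eval₂_eq_sum, Polynomial.sum_def, Polynomial.eval_finsetSum,
    Polynomial.eval_monomial]
  rw [integral_finsetSum]
  · refine Finset.sum_congr rfl fun k _ => ?_
    rw [← integral_mul_const]
    rfl
  · intro k _
    exact ((P.coeff k).continuous.mul continuous_const).continuousOn.integrableOn_compact' hB
      hB.measurableSet

/-- A small multiple of a Lipschitz map perturbs the identity to a bijection. -/
theorem bijective_id_add_smul {E : Type*} [NormedAddCommGroup E] [NormedSpace ℝ E]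
    [CompleteSpace E] {h : E → E} {C : NNReal} (hh : LipschitzWith C h) {t : ℝ}
    (ht : ‖t‖₊ * C < 1) : Function.Bijective fun x => x + t • h x := by
  have key : ApproximatesLinearOn (fun x => x + t • h x)
      ((ContinuousLinearEquiv.refl ℝ E : E ≃L[ℝ] E) : E →L[ℝ] E) Set.univ (‖t‖₊ * C) := by
    rw [ApproximatesLinearOn.approximatesLinearOn_iff_lipschitzOnWith, lipschitzOnWith_univ]
    have : ((fun x => x + t • h x) - ⇑((ContinuousLinearEquiv.refl ℝ E : E ≃L[ℝ] E) : E →L[ℝ] E))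
        = fun x => t • h x := by
      ext x; simp
    rw [this]
    exact (lipschitzWith_smul t).comp hh
  -- The identity has norm 1 only on a nontrivial space.
  rcases subsingleton_or_nontrivial E with hE | hE
  · exact ⟨fun _ _ _ => Subsingleton.elim _ _, fun b => ⟨b, Subsingleton.elim _ _⟩⟩
  have hc : ‖t‖₊ * C < ‖((ContinuousLinearEquiv.refl ℝ E).symm : E →L[ℝ] E)‖₊⁻¹ := by
    have : ‖((ContinuousLinearEquiv.refl ℝ E).symm : E →L[ℝ] E)‖₊ = 1 := by
      ext; exact ContinuousLinearMap.norm_id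
    rw [this, inv_one]
    exact ht
  exact ⟨Set.injOn_univ.1 (key.injOn (Or.inr hc)), key.surjective (Or.inr hc)⟩

/-- A bijection that is the identity outside `B` maps `B` onto itself. -/
theorem image_eq_self_of_forall_notMem {E : Type*} {B : Set E} {F : E → E}
    (hF : Function.Bijective F) (hB : ∀ x ∉ B, F x = x) : F '' B = B := by
  ext y
  constructor
  · rintro ⟨x, hx, rfl⟩
    by_contra hy
    exact hy (by rwa [hF.1 (hB _ hy)])
  · intro hy
    obtain ⟨x, rfl⟩ := hF.2 y
    by_cases hx : x ∈ B
    · exact ⟨x, hx, rfl⟩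
    · exact absurd (by rwa [hB x hx] at hy) hx

variable {ι : Type*} [Fintype ι]

open MeasureTheory in
/-- Change of variables for small perturbations `x + t h x` of the identity. -/
theorem setIntegral_det_id_add_smul [DecidableEq ι] {h : (ι → ℝ) → ι → ℝ} (hh : ContDiff ℝ 1 h)
    {B : Set (ι → ℝ)} (hB : IsCompact B) (h0 : ∀ x ∉ B, h x = 0) :
    ∃ τ > 0, ∀ t ∈ Set.Ioo (0 : ℝ) τ, ∀ p : (ι → ℝ) → ℝ,
      ∫ x in B, p x =
        ∫ x in B, (1 + t • LinearMap.toMatrix' (fderiv ℝ h x : (ι → ℝ) →ₗ[ℝ] ι → ℝ)).det *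
          p (x + t • h x) := by
  obtain ⟨C, hC⟩ := hh.lipschitzWith_of_hasCompactSupport (𝕂 := ℝ)
    (HasCompactSupport.intro hB fun x hx => h0 x hx) one_ne_zero
  have hcont : Continuous fun z : ℝ × (ι → ℝ) =>
      (1 + z.1 • LinearMap.toMatrix' (fderiv ℝ h z.2 : (ι → ℝ) →ₗ[ℝ] ι → ℝ)).det := by
    have h1 := hh.continuous_fderiv one_ne_zero
    refine Continuous.matrix_det (continuous_const.add (continuous_fst.smul ?_))
    refine continuous_matrix fun i j => ?_
    simp only [LinearMap.toMatrix'_apply, ContinuousLinearMap.coe_coe]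
    fun_prop
  -- Positivity removes the absolute value from the Jacobian, which leaves an expression polynomial
  -- in t.
  have hdet : ∀ᶠ t in 𝓝 (0 : ℝ), ∀ x ∈ B,
      0 < (1 + t • LinearMap.toMatrix' (fderiv ℝ h x : (ι → ℝ) →ₗ[ℝ] ι → ℝ)).det := by
    refine hB.eventually_forall_of_forall_eventually fun x _ => ?_
    exact hcont.continuousAt.eventually_const_lt (by simp)
  have hlip : ∀ᶠ t in 𝓝 (0 : ℝ), ‖t‖₊ * C < 1 := by
    have : Continuous fun t : ℝ => ‖t‖₊ * C := by fun_prop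
    exact this.continuousAt.eventually_lt_const (by simp)
  obtain ⟨τ, hτ, H⟩ := Metric.eventually_nhds_iff.1 (hdet.and hlip)
  refine ⟨τ, hτ, fun t ht p => ?_⟩
  obtain ⟨hd, hl⟩ := @H t (by simpa [abs_of_pos ht.1] using ht.2)
  have hbij := bijective_id_add_smul hC hl
  have himage := image_eq_self_of_forall_notMem (B := B) hbij fun x hx => by simp [h0 x hx]
  have hder : ∀ x ∈ B, HasFDerivWithinAt (fun x => x + t • h x)
      (ContinuousLinearMap.id ℝ (ι → ℝ) + t • fderiv ℝ h x) B x := fun x _ =>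
    ((hasFDerivAt_id x).add
      ((hh.differentiable one_ne_zero x).hasFDerivAt.const_smul t)).hasFDerivWithinAt
  conv_lhs => rw [← himage]
  rw [integral_image_eq_integral_abs_det_fderiv_smul volume hB.measurableSet hder hbij.1.injOn]
  refine setIntegral_congr_fun hB.measurableSet fun x hx => ?_
  have : (ContinuousLinearMap.id ℝ (ι → ℝ) + t • fderiv ℝ h x).det =
      (1 + t • LinearMap.toMatrix' (fderiv ℝ h x : (ι → ℝ) →ₗ[ℝ] ι → ℝ)).det := by
    rw [ContinuousLinearMap.det, ← LinearMap.det_toMatrix']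
    simp [LinearMap.toMatrix'_id]
  simp only [this, abs_of_pos (hd x hx), smul_eq_mul]

open MeasureTheory in
/-- The change of variables formula for powers of `K - |x|²` persists for the possibly non-injective
map `x + h x`, as both sides are polynomials in `t` along the family `x + t h x`. -/
theorem setIntegral_pow_id_add [DecidableEq ι] {h : (ι → ℝ) → ι → ℝ} (hh : ContDiff ℝ 1 h)
    {B : Set (ι → ℝ)} (hB : IsCompact B) (h0 : ∀ x ∉ B, h x = 0) (K : ℝ) (N : ℕ) :
    ∫ x in B, (K - ∑ i, x i ^ 2) ^ N =
      ∫ x in B, (1 + LinearMap.toMatrix' (fderiv ℝ h x : (ι → ℝ) →ₗ[ℝ] ι → ℝ)).det *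
          (K - ∑ i, (x + h x) i ^ 2) ^ N := by
  have h1 := hh.continuous_fderiv one_ne_zero
  have hcts := hh.continuous
  let coord : ι → C(ι → ℝ, ℝ) := fun i => ⟨fun x => x i, by fun_prop⟩
  let hcoord : ι → C(ι → ℝ, ℝ) := fun i => ⟨fun x => h x i, by fun_prop⟩
  let D : Matrix ι ι C(ι → ℝ, ℝ) := Matrix.of fun i j =>
    ⟨fun x => fderiv ℝ h x (Pi.single j 1) i, by fun_prop⟩
  let P : Polynomial C(ι → ℝ, ℝ) :=
    (1 + (Polynomial.X : Polynomial C(ι → ℝ, ℝ)) • D.map Polynomial.C).det *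
      (Polynomial.C (ContinuousMap.const _ K) -
        ∑ i, (Polynomial.C (coord i) + Polynomial.X * Polynomial.C (hcoord i)) ^ 2) ^ N
  have hP : ∀ (t : ℝ) (x : ι → ℝ),
      P.eval₂ (ContinuousMap.evalAlgHom ℝ ℝ x : C(ι → ℝ, ℝ) →+* ℝ) t =
      (1 + t • LinearMap.toMatrix' (fderiv ℝ h x : (ι → ℝ) →ₗ[ℝ] ι → ℝ)).det *
          (K - ∑ i, (x + t • h x) i ^ 2) ^ N := by
    intro t x
    rw [← Polynomial.coe_eval₂RingHom]
    simp only [P, map_mul, map_pow, map_sub, map_sum, map_add, RingHom.map_det]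
    congr 1
    · congr 1
      ext i j
      by_cases hij : i = j <;>
      simp [D, hij, LinearMap.toMatrix'_apply, mul_comm t]
    · simp [coord, hcoord]
  obtain ⟨Q, hQ⟩ := exists_polynomial_eval_eq_setIntegral (μ := volume) hB P
  obtain ⟨τ, hτ, H⟩ := setIntegral_det_id_add_smul hh hB h0
  -- Q takes a single value on the infinite set (0, τ), hence is constant and can be evaluated at t
  -- = 1, where injectivity may fail.
  have hconst : Q = Polynomial.C (∫ x in B, (K - ∑ i, x i ^ 2) ^ N) := by
    refine Polynomial.eq_of_infinite_eval_eq _ _ ((Set.Ioo_infinite hτ).mono fun t ht => ?_)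
    rw [Set.mem_ofPred_eq, ← hQ, Polynomial.eval_C, H t ht fun x => (K - ∑ i, x i ^ 2) ^ N]
    simp only [hP]
  have := hQ 1
  rw [hconst, Polynomial.eval_C] at this
  simpa only [hP, one_smul] using this.symm

open MeasureTheory Metric in
/-- A continuously differentiable compactly supported perturbation of the identity has a zero. -/
theorem exists_add_eq_zero_of_contDiff {h : (ι → ℝ) → ι → ℝ} (hh : ContDiff ℝ 1 h)
    {R : ℝ} (hR : 0 < R) (h0 : ∀ x ∉ closedBall 0 R, h x = 0) : ∃ x, x + h x = 0 := by
  classical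
  by_contra! hne
  set B : Set (ι → ℝ) := closedBall 0 R
  have hB : IsCompact B := isCompact_closedBall _ _
  have hcts := hh.continuous
  have h1 := hh.continuous_fderiv one_ne_zero
  -- The norm on `ι → ℝ` is the sup norm, which is not polynomial; the sum of squares is.
  set S : (ι → ℝ) → ℝ := fun x => ∑ i, x i ^ 2 with hS
  have hSc : Continuous S := by fun_prop
  have hSnn : ∀ x, 0 ≤ S x := fun x => Finset.sum_nonneg fun i _ => sq_nonneg _
  have hSpos : ∀ x, x ≠ 0 → 0 < S x := fun x hx => by
    refine lt_of_le_of_ne (hSnn x) fun h => hx ?_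
    ext i
    simpa using (Finset.sum_eq_zero_iff_of_nonneg fun i _ => sq_nonneg (x i)).1 h.symm i
      (Finset.mem_univ i)
  have hBne : B.Nonempty := ⟨0, by simp [B, hR.le]⟩
  obtain ⟨x₀, -, hx₀⟩ := hB.exists_isMinOn hBne
    (f := fun x => S (x + h x)) (by fun_prop)
  set δ := S (x₀ + h x₀) with hδ
  have hδpos : 0 < δ := hSpos _ (hne _)
  obtain ⟨K₁, hK₁⟩ := hB.exists_bound_of_continuousOn hSc.continuousOn
  obtain ⟨K₂, hK₂⟩ := hB.exists_bound_of_continuousOn (f := fun x => S (x + h x)) (by fun_prop)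
  set J : (ι → ℝ) → ℝ := fun x =>
    (1 + LinearMap.toMatrix' (fderiv ℝ h x : (ι → ℝ) →ₗ[ℝ] ι → ℝ)).det
  have hJc : Continuous J := by
    refine Continuous.matrix_det (continuous_const.add ?_)
    refine continuous_matrix fun i j => ?_
    simp only [LinearMap.toMatrix'_apply, ContinuousLinearMap.coe_coe]
    fun_prop
  obtain ⟨A, hA⟩ := hB.exists_bound_of_continuousOn hJc.continuousOn
  -- Large enough that K - S x and K - S (x + h x) are positive on B.
  set K := |K₁| + |K₂| + δ + 1
  have hKδ : δ < K := by
    have := abs_nonneg K₁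
    have := abs_nonneg K₂
    linarith
  set V : Set (ι → ℝ) := {x | S x < δ / 2} ∩ ball 0 R
  have hVo : IsOpen V := (isOpen_lt hSc continuous_const).inter isOpen_ball
  have hVB : V ⊆ B := Set.inter_subset_right.trans ball_subset_closedBall
  have hVpos : 0 < volume.real V := by
    have h2 : volume V ≠ 0 := (hVo.measure_pos volume ⟨0, by simp [hS, hδpos], by simpa⟩).ne'
    exact ENNReal.toReal_pos h2 ((measure_mono hVB).trans_lt hB.measure_lt_top).ne
  have hlow : ∀ N : ℕ, (K - δ / 2) ^ N * volume.real V ≤ ∫ x in B, (K - S x) ^ N := by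
    intro N
    have hint : IntegrableOn (fun x => (K - S x) ^ N) B := by
      refine ContinuousOn.integrableOn_compact hB (by fun_prop)
    have hnn : ∀ x ∈ B, 0 ≤ (K - S x) ^ N := fun x hx => by
      have := (abs_le.1 (hK₁ x hx)).2
      have := le_abs_self K₁
      have := abs_nonneg K₂
      exact pow_nonneg (by linarith) N
    calc (K - δ / 2) ^ N * volume.real V = ∫ x in V, (K - δ / 2) ^ N := by
          rw [setIntegral_const, smul_eq_mul, mul_comm]
      _ ≤ ∫ x in V, (K - S x) ^ N := by
          refine setIntegral_mono_on ?_ (hint.mono_set hVB) hVo.measurableSet fun x hx => ?_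
          · exact integrableOn_const (((measure_mono hVB).trans_lt hB.measure_lt_top).ne)
          · have : S x < δ / 2 := hx.1
            exact pow_le_pow_left₀ (by linarith) (by linarith) N
      _ ≤ ∫ x in B, (K - S x) ^ N :=
          setIntegral_mono_set hint
            ((ae_restrict_iff' hB.measurableSet).2 (Eventually.of_forall hnn))
            hVB.eventuallyLE
  have hup : ∀ N : ℕ, ∫ x in B, (K - S x) ^ N ≤ A * (K - δ) ^ N * volume.real B := by
    intro N
    rw [setIntegral_pow_id_add hh hB h0 K N]
    refine (Real.le_norm_self _).trans
      (norm_setIntegral_le_of_norm_le_const hB.measure_lt_top fun x hx => ?_)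
    have h3 := (abs_le.1 (hK₂ x hx)).2
    have h4 : δ ≤ S (x + h x) := hx₀ hx
    have h5 := le_abs_self K₂
    have h6 := abs_nonneg K₁
    rw [norm_mul, norm_pow]
    refine mul_le_mul (hA x hx) (pow_le_pow_left₀ (norm_nonneg _) ?_ N) (by positivity)
      ((norm_nonneg _).trans (hA x hx))
    rw [Real.norm_of_nonneg (by linarith)]
    linarith
  have hratio : Tendsto (fun N : ℕ => A * volume.real B * ((K - δ) / (K - δ / 2)) ^ N) atTop
      (𝓝 (A * volume.real B * 0)) := by
    refine (tendsto_pow_atTop_nhds_zero_of_lt_one ?_ ?_).const_mul _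
    · exact div_nonneg (by linarith) (by linarith)
    · rw [div_lt_one (by linarith)]; linarith
  rw [mul_zero] at hratio
  obtain ⟨N, hN⟩ := (hratio.eventually_lt_const hVpos).exists
  have hp : 0 < (K - δ / 2) ^ N := pow_pos (by linarith) N
  have := (hlow N).trans (hup N)
  rw [div_pow, mul_div_assoc', div_lt_iff₀ hp] at hN
  nlinarith

open Metric in
/-- A continuous compactly supported perturbation of the identity has a zero. -/
theorem exists_add_eq_zero_of_continuous {h : (ι → ℝ) → ι → ℝ} (hh : Continuous h)
    {R : ℝ} (hR : 0 < R) (h0 : ∀ x ∉ closedBall 0 R, h x = 0) : ∃ x, x + h x = 0 := by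
  by_contra! hne
  -- Radius 2R leaves room for the smooth approximation of h, whose support may grow by up to R.
  have hB : IsCompact (closedBall (0 : ι → ℝ) (2 * R)) := isCompact_closedBall _ _
  obtain ⟨x₀, -, hx₀⟩ := hB.exists_isMinOn ⟨0, by simp [hR.le]⟩
    (f := fun x => ‖x + h x‖) (by fun_prop)
  set δ := ‖x₀ + h x₀‖
  have hδ : 0 < δ := norm_pos_iff.2 (hne _)
  have hu : UniformContinuous h := (HasCompactSupport.intro (isCompact_closedBall _ _)
    fun x hx => h0 x hx).uniformContinuous_of_continuous hh
  obtain ⟨η, hη, hηh⟩ := Metric.uniformContinuous_iff.1 hu (δ / 2) (half_pos hδ)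
  obtain ⟨g, hg, hgh⟩ := hh.exists_contDiff_dist_le_of_forall_mem_ball_dist_le (lt_min hη hR)
  have hg0 : ∀ x ∉ closedBall 0 (2 * R), g x = 0 := by
    intro x hx
    have hout : ∀ y ∈ ball x (min η R), h y = 0 := by
      refine fun y hy => h0 y fun hy' => hx ?_
      have h1 : dist y x < R := (mem_ball.1 hy).trans_le (min_le_right _ _)
      rw [mem_closedBall] at hy' ⊢
      have := dist_triangle_left x 0 y
      linarith
    have hx0 : h x = 0 := hout x (mem_ball_self (lt_min hη hR))
    have := hgh x 0 fun y hy => by rw [hout y hy, hx0, dist_self]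
    rwa [hx0, dist_le_zero] at this
  obtain ⟨x, hx⟩ := exists_add_eq_zero_of_contDiff (hg.of_le (by simp)) (by positivity) hg0
  have hxB : x ∈ closedBall 0 (2 * R) := by
    by_contra hxB
    refine hxB ?_
    rw [hg0 x hxB, add_zero] at hx
    simp [hx, hR.le]
  have h1 : δ ≤ ‖x + h x‖ := hx₀ hxB
  have h2 : dist (g x) (h x) ≤ δ / 2 := hgh x _ fun y hy =>
    (hηh ((mem_ball.1 hy).trans_le (min_le_left _ _))).le
  have h3 : x + h x = -(g x - h x) := by
    linear_combination hx
  rw [h3, norm_neg, ← dist_eq_norm] at h1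
  linarith

/-! ### Poincaré–Miranda -/

open Metric in
/-- The **Poincaré–Miranda theorem** on a cube centred at the origin. -/
theorem exists_eq_zero_of_face_signs {F : (ι → ℝ) → ι → ℝ} {r : ℝ} (hr : 0 < r)
    (hF : ContinuousOn F (closedBall 0 r))
    (hpos : ∀ t ∈ closedBall (0 : ι → ℝ) r, ∀ i, t i = r → 0 < F t i)
    (hneg : ∀ t ∈ closedBall (0 : ι → ℝ) r, ∀ i, t i = -r → F t i < 0) :
    ∃ t ∈ closedBall (0 : ι → ℝ) r, F t = 0 := by
  let c : (ι → ℝ) → ι → ℝ := fun t i => max (-r) (min r (t i))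
  have hc : Continuous c := by fun_prop
  have hcr : ∀ t, c t ∈ closedBall (0 : ι → ℝ) r := fun t => by
    rw [mem_closedBall_zero_iff, pi_norm_le_iff_of_nonneg hr.le]
    exact fun i => abs_le.2 ⟨le_max_left _ _, max_le (by linarith) (min_le_left _ _)⟩
  have hcid : ∀ t ∈ closedBall (0 : ι → ℝ) r, c t = t := fun t ht => by
    rw [mem_closedBall_zero_iff, pi_norm_le_iff_of_nonneg hr.le] at ht
    ext i
    have := abs_le.1 (ht i)
    simp only [c]
    rw [min_eq_right this.2, max_eq_right this.1]
  -- A cutoff equal to 1 on the cube and 0 outside the doubled cube. With the clamp `c`, it makes t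
  -- + χ t (F (c t) - c t) a compactly supported perturbation of the identity that equals F on the
  -- cube.
  let χ : (ι → ℝ) → ℝ := fun t => max 0 (min 1 (2 - ‖t‖ / r))
  have hχ : Continuous χ := by fun_prop
  have hχ0 : ∀ t, 0 ≤ χ t := fun t => le_max_left _ _
  have hχ1 : ∀ t, χ t ≤ 1 := fun t => max_le zero_le_one (min_le_left _ _)
  have hFc : Continuous fun t => F (c t) := hF.comp_continuous hc hcr
  have hzero : ∀ t ∉ closedBall (0 : ι → ℝ) (2 * r), χ t • (F (c t) - c t) = 0 := fun t ht => by
    rw [mem_closedBall_zero_iff, not_le, ← lt_div_iff₀ hr] at ht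
    have : χ t = 0 := max_eq_left ((min_le_right _ _).trans (by linarith))
    rw [this, zero_smul]
  obtain ⟨t, ht⟩ := exists_add_eq_zero_of_continuous (hχ.smul (hFc.sub hc)) (by positivity) hzero
  change t + χ t • (F (c t) - c t) = 0 at ht
  by_cases htr : t ∈ closedBall (0 : ι → ℝ) r
  · refine ⟨t, htr, ?_⟩
    have h1 : χ t = 1 := by
      rw [mem_closedBall_zero_iff, ← div_le_one hr] at htr
      simp only [χ]
      rw [min_eq_left (by linarith), max_eq_right zero_le_one]
    rwa [hcid t htr, h1, one_smul, add_sub_cancel] at ht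
  -- If tᵢ > r, the i-th coordinate is tᵢ - χ r + χ Fᵢ(c t) with tᵢ > r ≥ χ r and Fᵢ(c t) > 0, so it
  -- cannot vanish; tᵢ < -r is symmetric.
  · exfalso
    have : ∃ i, r < |t i| := by
      by_contra! H
      exact htr (by rwa [mem_closedBall_zero_iff, pi_norm_le_iff_of_nonneg hr.le])
    obtain ⟨i, hi⟩ := this
    have hti : t i + χ t * (F (c t) i - c t i) = 0 := congrFun ht i
    have hχr := mul_le_mul_of_nonneg_right (hχ1 t) hr.le
    rcases lt_abs.1 hi with hi | hi
    · have hci : c t i = r := by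
        simp only [c]
        rw [min_eq_left hi.le, max_eq_right (by linarith)]
      have := mul_nonneg (hχ0 t) (hpos _ (hcr t) i hci).le
      rw [hci] at hti
      linarith
    · have hci : c t i = -r := by
        simp only [c]
        exact max_eq_left ((min_le_right _ _).trans (by linarith))
      have := mul_nonneg (hχ0 t) (neg_nonneg.2 (hneg _ (hcr t) i hci).le)
      rw [hci] at hti
      linarith

/-! ### Signs of increments from quasidifferentials -/

variable {X : Type*} [NormedAddCommGroup X] [NormedSpace ℝ X]

theorem supportFn_le_zero_iff {C : Set (WeakDual ℝ X)} {v : X} :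
    supportFn C v ≤ 0 ↔ ∀ φ ∈ C, φ v ≤ 0 := by
  simp [supportFn]

theorem lt_zero_of_supportFn_lt_zero {C : Set (WeakDual ℝ X)} {v : X} (h : supportFn C v < 0)
    {φ : WeakDual ℝ X} (hφ : φ ∈ C) : φ v < 0 := by
  have : ((φ v : ℝ) : EReal) ≤ supportFn C v :=
    le_iSup₂ (f := fun (φ : WeakDual ℝ X) (_ : φ ∈ C) => ((φ v : ℝ) : EReal)) φ hφ
  exact_mod_cast this.trans_lt h

/-- If every element of `A + ψ` is negative at `v`, for some `ψ ∈ B`, then `f` decreases at a linear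
rate in the directions close to `v` in a finite dimensional space. -/
theorem IsQuasidifferentialAtUnif.eventually_lt {f : X → ℝ} {x : X} {A B : Set (WeakDual ℝ X)}
    (hf : IsQuasidifferentialAtUnif f x A B) {ψ : WeakDual ℝ X} (hψ : ψ ∈ B) {v : X}
    (h : ∀ φ ∈ A, φ v + ψ v < 0) {T : Type*} [TopologicalSpace T] {P : T → X} {t₀ : T}
    (hP : ContinuousAt P t₀) (hv : P t₀ = v) (X₀ : Submodule ℝ X) [FiniteDimensional ℝ X₀]
    (hX₀ : ∀ t, P t - v ∈ X₀) :
    ∀ᶠ p : ℝ × T in 𝓝[>] 0 ×ˢ 𝓝 t₀, f (x + p.1 • P p.2) < f x := by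
  obtain ⟨a, b, ⟨⟨φ, hφ, rfl⟩, -⟩, hb, hd⟩ := hf.hasDirDerivAt v
  obtain ⟨d, hd', hu⟩ := hf.dirDifferentiableAtUnif v
  obtain rfl := tendsto_nhds_unique hd' hd
  -- φ attains the maximum over A, and the minimum b over B is at most ψ v.
  have hneg : φ v + b < 0 := (add_le_add_right (hb.2 ⟨ψ, hψ, rfl⟩) _).trans_lt (h φ hφ)
  have hPt : Tendsto P (𝓝 t₀) (𝓝[{v' : X | v' - v ∈ X₀}] v) :=
    tendsto_nhdsWithin_iff.2 ⟨hv ▸ hP, Eventually.of_forall hX₀⟩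
  have h1 := ((hu X₀ inferInstance).comp (tendsto_id.prodMap hPt)).eventually_lt_const hneg
  have h2 : ∀ᶠ p : ℝ × T in 𝓝[>] 0 ×ˢ 𝓝 t₀, 0 < p.1 := tendsto_fst self_mem_nhdsWithin
  filter_upwards [h1, h2] with p hp1 hp2
  have := (div_neg_iff.1 hp1).resolve_left fun h => absurd h.2 (not_lt.2 hp2.le)
  exact sub_neg.1 this.1

/-- If every element of `φ + B` is positive at `v`, for some `φ ∈ A`, then `f` increases at a linear
rate in the directions close to `v` in a finite dimensional space. -/
theorem IsQuasidifferentialAtUnif.eventually_gt {f : X → ℝ} {x : X} {A B : Set (WeakDual ℝ X)}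
    (hf : IsQuasidifferentialAtUnif f x A B) {φ : WeakDual ℝ X} (hφ : φ ∈ A) {v : X}
    (h : ∀ ψ ∈ B, 0 < φ v + ψ v) {T : Type*} [TopologicalSpace T] {P : T → X} {t₀ : T}
    (hP : ContinuousAt P t₀) (hv : P t₀ = v) (X₀ : Submodule ℝ X) [FiniteDimensional ℝ X₀]
    (hX₀ : ∀ t, P t - v ∈ X₀) :
    ∀ᶠ p : ℝ × T in 𝓝[>] 0 ×ˢ 𝓝 t₀, f x < f (x + p.1 • P p.2) := by
  obtain ⟨a, b, ha, ⟨⟨ψ, hψ, rfl⟩, -⟩, hd⟩ := hf.hasDirDerivAt v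
  obtain ⟨d, hd', hu⟩ := hf.dirDifferentiableAtUnif v
  obtain rfl := tendsto_nhds_unique hd' hd
  have hpos : 0 < a + ψ v := (h ψ hψ).trans_le (add_le_add_left (ha.2 ⟨φ, hφ, rfl⟩) _)
  have hPt : Tendsto P (𝓝 t₀) (𝓝[{v' : X | v' - v ∈ X₀}] v) :=
    tendsto_nhdsWithin_iff.2 ⟨hv ▸ hP, Eventually.of_forall hX₀⟩
  have h1 := ((hu X₀ inferInstance).comp (tendsto_id.prodMap hPt)).eventually_const_lt hpos
  have h2 : ∀ᶠ p : ℝ × T in 𝓝[>] 0 ×ˢ 𝓝 t₀, 0 < p.1 := tendsto_fst self_mem_nhdsWithin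
  filter_upwards [h1, h2] with p hp1 hp2
  have := (div_pos_iff.1 hp1).resolve_right fun h => absurd h.2 (not_lt.2 hp2.le)
  exact sub_pos.1 this.1

/-- The tube lemma for filters: it turns estimates near each point of a face of the cube into one
threshold for α on the whole face. -/
theorem eventually_forall_of_isCompact {T : Type*} [TopologicalSpace T] {K : Set T}
    (hK : IsCompact K) {l : Filter ℝ} {p : ℝ → T → Prop}
    (h : ∀ t ∈ K, ∀ᶠ q : ℝ × T in l ×ˢ 𝓝 t, p q.1 q.2) : ∀ᶠ α in l, ∀ t ∈ K, p α t :=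
  (show ∀ᶠ q : ℝ × T in l ×ˢ 𝓝ˢ K, p q.1 q.2 from hK.mem_prod_nhdsSet_of_forall h).curry.mono
    fun _ h => h.self_of_nhdsSet

theorem mem_contingentCone_of_forall {M : Set X} {x v : X}
    (h : ∀ ε > 0, ∃ α ∈ Set.Ioo 0 ε, ∃ u, dist u v < ε ∧ x + α • u ∈ M) :
    v ∈ contingentCone M x := by
  obtain ⟨ε, -, hε, hε0⟩ := exists_seq_strictAnti_tendsto (0 : ℝ)
  choose α hα u hu hM using fun n => h (ε n) (hε n)
  refine ⟨α, u, fun n => (hα n).1, ?_, ?_, hM⟩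
  · exact squeeze_zero (fun n => (hα n).1.le) (fun n => (hα n).2.le) hε0
  · exact tendsto_iff_dist_tendsto_zero.2
      (squeeze_zero (fun _ => dist_nonneg) (fun n => (hu n).le) hε0)

/-! ### The piecewise linear family of directions -/

/-- The piecewise linear family of directions moving from `v` along `w i` for positive and along
`u i` for negative values of the parameter `t i`. -/
noncomputable def twoSidedDirection (v : X) (u w : ι → X) (t : ι → ℝ) : X :=
  v + ∑ i, (max (t i) 0 • w i + max (-t i) 0 • u i)

theorem continuous_twoSidedDirection (v : X) (u w : ι → X) :
    Continuous (twoSidedDirection v u w) := by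
  unfold twoSidedDirection
  fun_prop

theorem twoSidedDirection_zero (v : X) (u w : ι → X) : twoSidedDirection v u w 0 = v := by
  simp [twoSidedDirection]

theorem twoSidedDirection_sub_mem (v : X) (u w : ι → X) (t t' : ι → ℝ) :
    twoSidedDirection v u w t - twoSidedDirection v u w t' ∈
      Submodule.span ℝ (Set.range u ∪ Set.range w) := by
  have h : ∀ t : ι → ℝ, ∑ i, (max (t i) 0 • w i + max (-t i) 0 • u i) ∈
      Submodule.span ℝ (Set.range u ∪ Set.range w) := fun t =>
    Submodule.sum_mem _ fun i _ => Submodule.add_mem _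
      (Submodule.smul_mem _ _ (Submodule.subset_span (Or.inr ⟨i, rfl⟩)))
      (Submodule.smul_mem _ _ (Submodule.subset_span (Or.inl ⟨i, rfl⟩)))
  simpa [twoSidedDirection] using Submodule.sub_mem _ (h t) (h t')

/-- For t i > 0 the term in `u i`, where φ has no prescribed sign, drops out. All other coefficients
are nonnegative, so no term can offset the positive one along `w i`; this is the reason for using
positive and negative parts. -/
theorem apply_twoSidedDirection_pos {Φ : Type*} [FunLike Φ X ℝ] [LinearMapClass Φ ℝ X ℝ] (φ : Φ)
    {v : X} {u w : ι → X} {t : ι → ℝ} {i : ι}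
    (hv : 0 ≤ φ v) (hu : ∀ k, k ≠ i → 0 ≤ φ (u k)) (hw : ∀ k, k ≠ i → 0 ≤ φ (w k))
    (hi : 0 < φ (w i)) (ht : 0 < t i) : 0 < φ (twoSidedDirection v u w t) := by
  simp only [twoSidedDirection, map_add, map_sum, map_smul, smul_eq_mul]
  refine add_pos_of_nonneg_of_pos hv (Finset.sum_pos' (fun k _ => ?_) ⟨i, Finset.mem_univ i, ?_⟩)
  · by_cases hk : k = i
    · subst hk
      rw [max_eq_right (neg_nonpos.2 ht.le), zero_mul, add_zero]
      exact mul_nonneg (le_max_right _ _) hi.le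
    · exact add_nonneg (mul_nonneg (le_max_right _ _) (hw k hk))
        (mul_nonneg (le_max_right _ _) (hu k hk))
  · rw [max_eq_right (neg_nonpos.2 ht.le), zero_mul, add_zero, max_eq_left ht.le]
    exact mul_pos ht hi

theorem twoSidedDirection_neg (v : X) (u w : ι → X) (t : ι → ℝ) :
    twoSidedDirection v u w (-t) = twoSidedDirection v w u t := by
  simp [twoSidedDirection, add_comm]

theorem apply_twoSidedDirection_neg {Φ : Type*} [FunLike Φ X ℝ] [LinearMapClass Φ ℝ X ℝ] (φ : Φ)
    {v : X} {u w : ι → X} {t : ι → ℝ} {i : ι}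
    (hv : φ v ≤ 0) (hu : ∀ k, k ≠ i → φ (u k) ≤ 0) (hw : ∀ k, k ≠ i → φ (w k) ≤ 0)
    (hi : φ (u i) < 0) (ht : t i < 0) : φ (twoSidedDirection v u w t) < 0 := by
  have := apply_twoSidedDirection_pos (-(φ : X →ₗ[ℝ] ℝ)) (v := v) (u := w) (w := u) (t := -t)
    (i := i) (by simpa) (by simpa) (by simpa) (by simpa) (by simpa)
  rw [twoSidedDirection_neg] at this
  simpa using this

end Quasidiff
-- The contingent cone inclusion
theorem mainTheorem1 {X : Type*} [NormedAddCommGroup X] [NormedSpace ℝ X] [CompleteSpace X]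
    {m l : ℕ} (f : Fin m → X → ℝ) (g : Fin l → X → ℝ) (xbar : X)
    (hxbar : xbar ∈ Quasidiff.constraintSet f g)
    (hf_cont : ∀ i, ∃ U ∈ 𝓝 xbar, ContinuousOn (f i) U)
    (hg_usc : ∀ j, j ∉ Quasidiff.activeSet g xbar → UpperSemicontinuousAt (g j) xbar)
    -- the given quasidifferentials `[subF i, superF i]` of `f i` and `[subG j, superG j]` of `g j`
    (subF superF : Fin m → Set (WeakDual ℝ X)) (subG superG : Fin l → Set (WeakDual ℝ X))
    (hf_qd : ∀ i, Quasidiff.IsQuasidifferentialAtUnif (f i) xbar (subF i) (superF i))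
    (hg_qd : ∀ j ∈ Quasidiff.activeSet g xbar,
      Quasidiff.IsQuasidifferentialAtUnif (g j) xbar (subG j) (superG j))
    (x y : Fin m → WeakDual ℝ X) (z : Fin l → WeakDual ℝ X)
    (hx : ∀ i, x i ∈ subF i) (hy : ∀ i, y i ∈ superF i)
    (hz : ∀ j ∈ Quasidiff.activeSet g xbar, z j ∈ superG j)
    (hCQ1 : ∀ i, ∃ v : X, Quasidiff.supportFn (subF i + {y i}) v < 0 ∧
      ∀ k, k ≠ i → Quasidiff.supportFn (subF k + {y k}) v ≤ 0 ∧
        Quasidiff.supportFn ({-x k} - superF k) v ≤ 0)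
    (hCQ2 : ∀ i, ∃ w : X, Quasidiff.supportFn ({-x i} - superF i) w < 0 ∧
      ∀ k, k ≠ i → Quasidiff.supportFn ({-x k} - superF k) w ≤ 0 ∧
        Quasidiff.supportFn (subF k + {y k}) w ≤ 0)
    (hCQ3 : ∃ v₀ : X,
      (∀ j ∈ Quasidiff.activeSet g xbar, Quasidiff.supportFn (subG j + {z j}) v₀ < 0) ∧
      ∀ i, Quasidiff.supportFn (subF i + {y i}) v₀ ≤ 0 ∧
        Quasidiff.supportFn ({-x i} - superF i) v₀ ≤ 0) :
    {v : X | (∀ i, Quasidiff.supportFn (subF i + {y i}) v ≤ 0 ∧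
        Quasidiff.supportFn ({-x i} - superF i) v ≤ 0) ∧
      ∀ j ∈ Quasidiff.activeSet g xbar, Quasidiff.supportFn (subG j + {z j}) v ≤ 0} ⊆
      Quasidiff.contingentCone (Quasidiff.constraintSet f g) xbar := by
  intro v ⟨hvf, hvg⟩
  refine Quasidiff.mem_contingentCone_of_forall fun ε hε => ?_
  obtain ⟨v₀, hv₀g, hv₀f⟩ := hCQ3
  choose V hV hV' using hCQ1
  choose W hW hW' using hCQ2
  have hsub : ∀ k u, Quasidiff.supportFn (subF k + {y k}) u ≤ 0 →
      ∀ φ ∈ subF k, (φ + y k) u ≤ 0 := fun k u h φ hφ =>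
    Quasidiff.supportFn_le_zero_iff.1 h _ (Set.add_mem_add hφ rfl)
  have hsup : ∀ k u, Quasidiff.supportFn ({-x k} - superF k) u ≤ 0 →
      ∀ ψ ∈ superF k, 0 ≤ (x k + ψ) u := fun k u h ψ hψ => by
    have h1 : -x k u - ψ u ≤ 0 :=
      Quasidiff.supportFn_le_zero_iff.1 h (-x k - ψ) (Set.sub_mem_sub rfl hψ)
    change 0 ≤ x k u + ψ u
    linarith
  have hsub' : ∀ k, ∀ φ ∈ subF k, (φ + y k) (V k) < 0 := fun k φ hφ =>
    Quasidiff.lt_zero_of_supportFn_lt_zero (hV k) (Set.add_mem_add hφ rfl)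
  have hsup' : ∀ k, ∀ ψ ∈ superF k, 0 < (x k + ψ) (W k) := fun k ψ hψ => by
    have h1 : -x k (W k) - ψ (W k) < 0 :=
      Quasidiff.lt_zero_of_supportFn_lt_zero (hW k) (φ := -x k - ψ) (Set.sub_mem_sub rfl hψ)
    change 0 < x k (W k) + ψ (W k)
    linarith
  obtain ⟨s, hs, hsε⟩ : ∃ s > 0, s * ‖v₀‖ < ε :=
    ⟨ε / (‖v₀‖ + 1), by positivity, by
      rw [div_mul_eq_mul_div, div_lt_iff₀ (by positivity)]
      nlinarith⟩
  set u := v + s • v₀ with hu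
  have hlin : ∀ φ : WeakDual ℝ X, φ u = φ v + s * φ v₀ := fun φ => by
    rw [hu, map_add, map_smul, smul_eq_mul]
  set P := Quasidiff.twoSidedDirection u V W
  have hPc : Continuous P := Quasidiff.continuous_twoSidedDirection u V W
  have hP0 : P 0 = u := Quasidiff.twoSidedDirection_zero u V W
  -- All differences P t - P t' lie in this one finite dimensional space, so uniformity along it
  -- suffices.
  set X₀ := Submodule.span ℝ (Set.range V ∪ Set.range W)
  have hX₀ : ∀ t t', P t - P t' ∈ X₀ := Quasidiff.twoSidedDirection_sub_mem u V W
  have : FiniteDimensional ℝ X₀ :=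
    FiniteDimensional.span_of_finite ℝ ((Set.finite_range V).union (Set.finite_range W))
  have hlim : Tendsto (fun p : ℝ × (Fin m → ℝ) => xbar + p.1 • P p.2) (𝓝[>] 0 ×ˢ 𝓝 0)
      (𝓝 xbar) := by
    have h1 : Continuous fun p : ℝ × (Fin m → ℝ) => xbar + p.1 • P p.2 := by fun_prop
    have h2 := h1.tendsto (0, 0)
    rw [nhds_prod_eq, zero_smul, add_zero] at h2
    exact h2.mono_left (prod_mono_left _ nhdsWithin_le_nhds)
  have hnear : ∀ᶠ p : ℝ × (Fin m → ℝ) in 𝓝[>] 0 ×ˢ 𝓝 0, dist (P p.2) v < ε := by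
    have h1 : Continuous fun t => dist (P t) v := by fun_prop
    refine tendsto_snd.eventually (h1.continuousAt.eventually_lt_const ?_)
    simp only [hP0]
    rw [hu, dist_eq_norm, add_sub_cancel_left, norm_smul, Real.norm_of_nonneg hs.le]
    exact hsε
  have hcont : ∀ᶠ p : ℝ × (Fin m → ℝ) in 𝓝[>] 0 ×ˢ 𝓝 0,
      ∀ i, ContinuousAt (f i) (xbar + p.1 • P p.2) := by
    refine eventually_all.2 fun i => ?_
    obtain ⟨U, hU, hfU⟩ := hf_cont i
    filter_upwards [hlim.eventually (eventually_mem_nhds_iff.2 hU)] with p hp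
      using hfU.continuousAt hp
  have hg : ∀ᶠ p : ℝ × (Fin m → ℝ) in 𝓝[>] 0 ×ˢ 𝓝 0, ∀ j, g j (xbar + p.1 • P p.2) ≤ 0 := by
    refine eventually_all.2 fun j => ?_
    by_cases hj : j ∈ Quasidiff.activeSet g xbar
    · have h1 := (hg_qd j hj).eventually_lt (hz j hj) (v := u) (P := P) (fun φ hφ => ?_)
        hPc.continuousAt hP0 X₀ fun t => by simpa only [hP0] using hX₀ t 0
      · filter_upwards [h1] with p hp using (hp.trans_eq hj).le
      · have h2 : φ v + z j v ≤ 0 :=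
          Quasidiff.supportFn_le_zero_iff.1 (hvg j hj) (φ + z j) (Set.add_mem_add hφ rfl)
        have h3 : φ v₀ + z j v₀ < 0 :=
          Quasidiff.lt_zero_of_supportFn_lt_zero (hv₀g j hj) (φ := φ + z j)
            (Set.add_mem_add hφ rfl)
        rw [hlin, hlin]
        nlinarith
    · have h1 : g j xbar < 0 := lt_of_le_of_ne (hxbar.2 j) hj
      filter_upwards [hlim.eventually (hg_usc j hj 0 h1)] with p hp using hp.le
  obtain ⟨pa, hpa, pb, hpb, hab⟩ := eventually_prod_iff.1 (hnear.and (hcont.and hg))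
  -- The cube is fixed independently of α, so the face estimates below only need α small for this r.
  obtain ⟨r, hr, hrb⟩ := Metric.nhds_basis_closedBall.mem_iff.1 hpb
  have hface : ∀ (i : Fin m) (c : ℝ),
      IsCompact (Metric.closedBall (0 : Fin m → ℝ) r ∩ {t | t i = c}) := fun i c =>
    (isCompact_closedBall _ _).inter_right (isClosed_eq (continuous_apply i) continuous_const)
  have hpos : ∀ᶠ α in 𝓝[>] (0 : ℝ), ∀ i,
      ∀ t ∈ Metric.closedBall (0 : Fin m → ℝ) r ∩ {t | t i = r},
      0 < f i (xbar + α • P t) := by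
    refine eventually_all.2 fun i => Quasidiff.eventually_forall_of_isCompact (hface i r) ?_
    intro t ht
    suffices h : ∀ᶠ q : ℝ × (Fin m → ℝ) in 𝓝[>] 0 ×ˢ 𝓝 t, f i xbar < f i (xbar + q.1 • P q.2) by
      simpa only [hxbar.1 i] using h
    refine (hf_qd i).eventually_gt (hx i) (v := P t) (fun ψ hψ => ?_) hPc.continuousAt rfl X₀
      fun t' => hX₀ t' t
    -- The conditions attached to the directions of index k ≠ i are used here for the constraint i;
    -- the strict one comes from `W i`.
    refine Quasidiff.apply_twoSidedDirection_pos (x i + ψ) (i := i) ?_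
      (fun k hk => hsup i _ (hV' k i hk.symm).2 ψ hψ)
      (fun k hk => hsup i _ (hW' k i hk.symm).1 ψ hψ) (hsup' i ψ hψ) (hr.trans_eq ht.2.symm)
    rw [hlin]
    exact add_nonneg (hsup i _ (hvf i).2 ψ hψ) (mul_nonneg hs.le (hsup i _ (hv₀f i).2 ψ hψ))
  have hneg : ∀ᶠ α in 𝓝[>] (0 : ℝ), ∀ i,
      ∀ t ∈ Metric.closedBall (0 : Fin m → ℝ) r ∩ {t | t i = -r}, f i (xbar + α • P t) < 0 := by
    refine eventually_all.2 fun i => Quasidiff.eventually_forall_of_isCompact (hface i (-r)) ?_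
    intro t ht
    suffices h : ∀ᶠ q : ℝ × (Fin m → ℝ) in 𝓝[>] 0 ×ˢ 𝓝 t, f i (xbar + q.1 • P q.2) < f i xbar by
      simpa only [hxbar.1 i] using h
    refine (hf_qd i).eventually_lt (hy i) (v := P t) (fun φ hφ => ?_) hPc.continuousAt rfl X₀
      fun t' => hX₀ t' t
    refine Quasidiff.apply_twoSidedDirection_neg (φ + y i) (i := i) ?_
      (fun k hk => hsub i _ (hV' k i hk.symm).1 φ hφ)
      (fun k hk => hsub i _ (hW' k i hk.symm).2 φ hφ) (hsub' i φ hφ)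
      (ht.2.trans_lt (neg_neg_of_pos hr))
    rw [hlin]
    exact add_nonpos (hsub i _ (hvf i).1 φ hφ)
      (mul_nonpos_of_nonneg_of_nonpos hs.le (hsub i _ (hv₀f i).1 φ hφ))
  obtain ⟨α, hαa, hαp, hαn, hα⟩ := (hpa.and (hpos.and (hneg.and (Ioo_mem_nhdsGT hε)))).exists
  obtain ⟨t, ht, hft⟩ := Quasidiff.exists_eq_zero_of_face_signs
    (F := fun t i => f i (xbar + α • P t)) hr
    (continuousOn_pi.2 fun i t ht => by
      have h1 : Continuous fun t => xbar + α • P t := by fun_prop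
      exact (((hab hαa (hrb ht)).2.1 i).comp (f := fun t => xbar + α • P t)
        h1.continuousAt).continuousWithinAt)
    (fun t ht i hti => hαp i t ⟨ht, hti⟩) (fun t ht i hti => hαn i t ⟨ht, hti⟩)
  obtain ⟨h1, -, h2⟩ := hab hαa (hrb ht)
  exact ⟨α, hα, P t, h1, fun i => congrFun hft i, h2⟩
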